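/- For $k\ge 1$ let $\mathbf C_k$ be the $k$-element Heyting chain $0<1<\dots<k-1$, where $a\to b=\top$ if $a\le b$ and $a\to b=b$ otherwise, and let $\mathcal G_k=\mathbb{ISP}(\mathbf C_k)$ be the variety (equivalently, quasivariety) of Heyting algebras generated by $\mathbf C_k$. Let $\mathbf M$ be a finite algebra. A total (single-sorted) alter ego of $\mathbf M$ is a topological structure $\mathbb M=(M;G,R,\mathcal T)$, where $G$ is a set of finitary total operations that are homomorphisms $\mathbf M^k\to\mathbf M$, $R$ is a set of finitary relations that are subuniverses of powers $\mathbf M^k$, and $\mathcal T$ is the discrete topology (no partial operations occur). Let $\mathcal X$ be the class of isomorphic copies of closed substructures (possibly empty) of nonzero powers of $\mathbb M$, with the continuous structure-preserving maps as morphisms. For $\mathbf A\in\mathbb{ISP}(\mathbf M)$ let $D(\mathbf A)=\mathrm{Hom}(\mathbf A,\mathbf M)\le\mathbb M^A$, and for $\mathbf X\in\mathcal X$ let $E(\mathbf X)=\mathcal X(\mathbf X,\mathbb M)\le\mathbf M^X$. The alter ego $\mathbb M$ yields a duality on $\mathbb{ISP}(\mathbf M)$ if for every $\mathbf A\in\mathbb{ISP}(\mathbf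 M)$ the evaluation map $e_{\mathbf A}\colon\mathbf A\to ED(\mathbf A)$, $e_{\mathbf A}(a)(x)=x(a)$, is an isomorphism; the duality is full if moreover $DE(\mathbf X)\cong\mathbf X$ for all $\mathbf X\in\mathcal X$. The alter ego yields a strong duality if it yields a duality and every closed substructure $X$ of every nonzero power $\mathbb M^S$ is term-closed, i.e. for each $y\in M^S\setminus X$ there are $S$-ary term functions $\sigma,\tau\colon M^S\to M$ of $\mathbf M$ with $\sigma|_X=\tau|_X$ and $\sigma(y)\ne\tau(y)$; another standard definition, equivalent to this one, is that $\mathbb M$ yields a full duality and is injective in $\mathcal X$ with respect to embeddings. Corollary. Let $n\ge 4$. The variety $\mathcal G_n$ admits no total single-sorted strong duality: if $\mathbf M$ is any finite algebra with $\mathbb{ISP}(\mathbf M)=\mathcal G_n$ (for instance $\mathbf M=\mathbf C_n$), then no total alter ego of $\mathbf M$ yields a strong duality on $\mathcal G_n$, in either of the two senses above. -/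

import Mathlib

universe u v

/-! ## Gödel chains and the classes `ISP(M)` -/

/-- The `n`-element Heyting chain `Cₙ`, with elements `0 < 1 < ⋯ < n - 1`. -/
abbrev GodelChain (n : ℕ) : Type := Fin n

/-- The implication of `Cₙ`. -/
theorem GodelChain.himp_eq (n : ℕ) [NeZero n] (a b : GodelChain n) :
    a ⇨ b = if a ≤ b then ⊤ else b := by
  split_ifs with h
  · exact himp_eq_top_iff.mpr h
  · refine le_antisymm ?_ le_himp
    have h1 : (a ⇨ b) ⊓ a ≤ b := himp_inf_le
    rcases inf_le_iff.mp h1 with h2 | h2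
    · exact h2
    · exact absurd h2 h

/-- `A` belongs to `ISP(M)`: it embeds, as a Heyting algebra, into a power of `M`. -/
def InISP (A : Type u) [HeytingAlgebra A] (M : Type v) [HeytingAlgebra M] : Prop :=
  ∃ (S : Type u) (f : HeytingHom A (S → M)), Function.Injective f

/-- `A` belongs to the variety `𝒢ₙ = ISP(Cₙ)`. -/
def InGodelVariety (n : ℕ) [NeZero n] (A : Type u) [HeytingAlgebra A] : Prop :=
  InISP A (GodelChain n)

/-- Subuniverses of a Heyting algebra. -/
structure IsHeytingSubuniverse {A : Type u} [HeytingAlgebra A] (r : Set A) : Prop where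
  bot_mem : ⊥ ∈ r
  top_mem : ⊤ ∈ r
  inf_mem : ∀ a ∈ r, ∀ b ∈ r, a ⊓ b ∈ r
  sup_mem : ∀ a ∈ r, ∀ b ∈ r, a ⊔ b ∈ r
  himp_mem : ∀ a ∈ r, ∀ b ∈ r, a ⇨ b ∈ r

/-- The homomorphism `a ↦ (v₁ a, …, vₖ a)` into a finite power. -/
def HeytingHom.tuple {A : Type u} {M : Type v} [HeytingAlgebra A] [HeytingAlgebra M] {k : ℕ}
    (w : Fin k → HeytingHom A M) : HeytingHom A (Fin k → M) where
  toFun a := fun i => w i a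
  map_sup' a b := by funext i; simp
  map_inf' a b := by funext i; simp
  map_bot' := by funext i; simp
  map_himp' a b := by funext i; simp

/-! ## Total alter egos and their topological structures

Throughout, the finite algebra `M` carries the discrete topology. -/

/-- A total (single-sorted) alter ego `(M; G, R, 𝒯)` of the algebra `M`: a set `G` of finitary
total operations on `M` which are homomorphisms `Mᵏ → M`, and a set `R` of finitary relations on
`M` which are subuniverses of `Mᵏ`. There are no (non-total) partial operations. -/
structure TotalAlterEgo (M : Type u) [HeytingAlgebra M] where
  ops : ∀ k : ℕ, Set (HeytingHom (Fin k → M) M)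
  rels : ∀ k : ℕ, Set (Set (Fin k → M))
  rels_algebraic : ∀ k, ∀ r ∈ rels k, IsHeytingSubuniverse r

namespace TotalAlterEgo

section

variable {M : Type u} [HeytingAlgebra M] (𝕄 : TotalAlterEgo M)

/-- Topological structures of the same type as the alter ego `𝕄`. -/
structure Str where
  carrier : Type u
  [top : TopologicalSpace carrier]
  op : ∀ k : ℕ, 𝕄.ops k → (Fin k → carrier) → carrier
  rel : ∀ k : ℕ, 𝕄.rels k → Set (Fin k → carrier)

attribute [instance] Str.top

variable {𝕄}

/-- Morphisms: continuous structure-preserving maps. -/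
@[ext]
structure Hom (X Y : 𝕄.Str) where
  toFun : X.carrier → Y.carrier
  continuous_toFun : Continuous toFun
  map_op : ∀ k (g : 𝕄.ops k) (w : Fin k → X.carrier),
    toFun (X.op k g w) = Y.op k g (fun i => toFun (w i))
  map_rel : ∀ k (r : 𝕄.rels k) (w : Fin k → X.carrier),
    w ∈ X.rel k r → (fun i => toFun (w i)) ∈ Y.rel k r

/-- Embeddings: isomorphisms onto a substructure of the codomain. -/
structure Hom.IsEmbedding {X Y : 𝕄.Str} (φ : Hom X Y) : Prop where
  isEmbedding_toFun : Topology.IsEmbedding φ.toFun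
  reflects_rel : ∀ k (r : 𝕄.rels k) (w : Fin k → X.carrier),
    (fun i => φ.toFun (w i)) ∈ Y.rel k r → w ∈ X.rel k r

/-- `X` and `Y` are isomorphic: there are mutually inverse morphisms between them. -/
def Isomorphic (X Y : 𝕄.Str) : Prop :=
  ∃ (φ : Hom X Y) (ψ : Hom Y X),
    (∀ x, ψ.toFun (φ.toFun x) = x) ∧ ∀ y, φ.toFun (ψ.toFun y) = y

variable [TopologicalSpace M] (𝕄)

/-- The alter ego as a topological structure. -/
def self : 𝕄.Str where
  carrier := M
  op _ g w := g.1 w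
  rel _ r := r.1

/-- The power `𝕄^S`, with product topology and pointwise operations and relations. -/
def power (S : Type u) : 𝕄.Str where
  carrier := S → M
  op _ g w := fun s => g.1 (fun i => w i s)
  rel _ r := {w | ∀ s, (fun i => w i s) ∈ r.1}

variable {𝕄}

/-- `X` is isomorphic to a topologically closed substructure of a nonzero power of `𝕄`,
i.e. it belongs to the topological quasivariety generated by `𝕄`. The empty structure is
included. -/
def InTopQuasivariety (X : 𝕄.Str) : Prop :=
  ∃ (S : Type u) (_ : Nonempty S) (φ : Hom X (𝕄.power S)),
    φ.IsEmbedding ∧ IsClosed (Set.range φ.toFun)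

variable (𝕄)

/-! ## The hom-functors on objects and the evaluation maps -/

/-- The dual `D(A)` of an algebra `A`: the set of homomorphisms `A → M` as a substructure of the
power `𝕄^A`. -/
def D (A : Type u) [HeytingAlgebra A] : 𝕄.Str where
  carrier := HeytingHom A M
  top := TopologicalSpace.induced (fun x => (x : A → M)) inferInstance
  op _ g w := g.1.comp (HeytingHom.tuple w)
  rel _ r := {w | ∀ a, (fun i => w i a) ∈ r.1}

end

section

variable {M : Type u} [HeytingAlgebra M] [TopologicalSpace M] {𝕄 : TotalAlterEgo M}

/-- The underlying set of the algebra `E(X)`: the set of morphisms `X → 𝕄`. -/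
def E (X : 𝕄.Str) : Type u := Hom X 𝕄.self

namespace E

variable {X : 𝕄.Str}

/-- The map underlying an element of `E(X)`. -/
def toMap (f : E X) : X.carrier → M := Hom.toFun f

theorem toMap_injective : Function.Injective (toMap (X := X)) := by
  intro f g h
  exact Hom.ext h

theorem continuous_toMap (f : E X) : Continuous f.toMap := Hom.continuous_toFun f

theorem toMap_op (f : E X) {k : ℕ} (g : 𝕄.ops k) (w : Fin k → X.carrier) :
    f.toMap (X.op k g w) = g.1 (fun i => f.toMap (w i)) := Hom.map_op f k g w

theorem toMap_rel (f : E X) {k : ℕ} (r : 𝕄.rels k) (w : Fin k → X.carrier)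
    (hw : w ∈ X.rel k r) : (fun i => f.toMap (w i)) ∈ r.1 := Hom.map_rel f k r w hw

variable [DiscreteTopology M]

/-- Morphisms `X → 𝕄` are closed under a binary operation of `M`, applied pointwise, which
commutes with the operations and preserves the relations of `𝕄`. -/
def map₂ (b : M → M → M)
    (hop : ∀ k (g : 𝕄.ops k) (w z : Fin k → M),
      g.1 (fun i => b (w i) (z i)) = b (g.1 w) (g.1 z))
    (hrel : ∀ k (r : 𝕄.rels k), ∀ w ∈ r.1, ∀ z ∈ r.1, (fun i => b (w i) (z i)) ∈ r.1)
    (f g : E X) : E X where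
  toFun x := b (f.toMap x) (g.toMap x)
  continuous_toFun :=
    (continuous_of_discreteTopology (f := fun p : M × M => b p.1 p.2)).comp
      (f.continuous_toMap.prodMk g.continuous_toMap)
  map_op k h w := by
    change b _ _ = h.1 (fun i => b (f.toMap (w i)) (g.toMap (w i)))
    rw [hop, toMap_op, toMap_op]
  map_rel k r w hw := hrel k r _ (f.toMap_rel r w hw) _ (g.toMap_rel r w hw)

instance : Max (E X) := ⟨map₂ (· ⊔ ·) (fun _ g w z => map_sup g.1 w z)
  (fun k r w hw z hz => (𝕄.rels_algebraic k r.1 r.2).sup_mem w hw z hz)⟩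

instance : Min (E X) := ⟨map₂ (· ⊓ ·) (fun _ g w z => map_inf g.1 w z)
  (fun k r w hw z hz => (𝕄.rels_algebraic k r.1 r.2).inf_mem w hw z hz)⟩

instance : HImp (E X) := ⟨map₂ (· ⇨ ·) (fun _ g w z => map_himp g.1 w z)
  (fun k r w hw z hz => (𝕄.rels_algebraic k r.1 r.2).himp_mem w hw z hz)⟩

instance : Bot (E X) := ⟨{
  toFun := fun _ => (⊥ : M)
  continuous_toFun := continuous_const
  map_op := fun _ g _ => (map_bot g.1).symm
  map_rel := fun k r _ _ => (𝕄.rels_algebraic k r.1 r.2).bot_mem }⟩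

instance : Top (E X) := ⟨{
  toFun := fun _ => (⊤ : M)
  continuous_toFun := continuous_const
  map_op := fun _ g _ => (map_top g.1).symm
  map_rel := fun k r _ _ => (𝕄.rels_algebraic k r.1 r.2).top_mem }⟩

instance : Compl (E X) := ⟨fun f => f ⇨ ⊥⟩

instance : LE (E X) := ⟨fun f g => f.toMap ≤ g.toMap⟩

instance : LT (E X) := ⟨fun f g => f.toMap < g.toMap⟩

/-- `E(X)` is a Heyting algebra under the pointwise operations. -/
instance : HeytingAlgebra (E X) :=
  toMap_injective.heytingAlgebra (toMap (X := X)) Iff.rfl Iff.rfl (fun _ _ => rfl)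
    (fun _ _ => rfl) rfl rfl (fun f => himp_bot f.toMap) (fun _ _ => rfl)

end E

variable [DiscreteTopology M] (𝕄)

/-- The evaluation map `e_A : A → ED(A)`, `e_A(a)(x) = x(a)`. -/
def eval (A : Type u) [HeytingAlgebra A] : HeytingHom A (E (𝕄.D A)) where
  toFun a :=
    { toFun := fun x : HeytingHom A M => x a
      continuous_toFun := (continuous_apply a).comp continuous_induced_dom
      map_op := fun _ _ _ => rfl
      map_rel := fun _ _ _ hw => hw a }
  map_sup' a b := E.toMap_injective (funext fun x : HeytingHom A M => map_sup x a b)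
  map_inf' a b := E.toMap_injective (funext fun x : HeytingHom A M => map_inf x a b)
  map_bot' := E.toMap_injective (funext fun x : HeytingHom A M => map_bot x)
  map_himp' a b := E.toMap_injective (funext fun x : HeytingHom A M => map_himp x a b)

/-! ## Dualities, full dualities, strong dualities -/

/-- `𝕄` yields a duality on `ISP(M)`: each evaluation map `e_A : A → ED(A)` is an isomorphism. -/
def YieldsDuality : Prop :=
  ∀ (A : Type u) [HeytingAlgebra A], InISP A M → Function.Bijective (𝕄.eval A)

/-- `𝕄` yields a full duality on `ISP(M)`: it yields a duality and `DE(X) ≅ X` for every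
structure `X` in the topological quasivariety generated by `𝕄`. -/
def YieldsFullDuality : Prop :=
  𝕄.YieldsDuality ∧ ∀ X : 𝕄.Str, InTopQuasivariety X → Isomorphic (𝕄.D (E X)) X

/-- `𝕄` is injective, with respect to embeddings, in the topological quasivariety it generates. -/
def IsInjective : Prop :=
  ∀ X Y : 𝕄.Str, InTopQuasivariety X → InTopQuasivariety Y →
    ∀ φ : Hom X Y, φ.IsEmbedding → ∀ α : Hom X 𝕄.self,
      ∃ β : Hom Y 𝕄.self, ∀ x, β.toFun (φ.toFun x) = α.toFun x

/-- A set of points of the power `𝕄^S` is the universe of a closed substructure. -/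
structure IsClosedSubstructure (S : Type u) (X : Set (S → M)) : Prop where
  isClosed : IsClosed X
  op_mem : ∀ k (g : 𝕄.ops k) (w : Fin k → S → M), (∀ i, w i ∈ X) →
    (fun s => g.1 (fun i => w i s)) ∈ X

end

end TotalAlterEgo

/-- The `S`-ary term functions `M^S → M` of the Heyting algebra `M`. -/
inductive IsTermFunction {M : Type u} [HeytingAlgebra M] {S : Type u} : ((S → M) → M) → Prop
  | proj (s : S) : IsTermFunction (fun y => y s)
  | bot : IsTermFunction (fun _ => ⊥)
  | top : IsTermFunction (fun _ => ⊤)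
  | inf {σ τ : (S → M) → M} : IsTermFunction σ → IsTermFunction τ →
      IsTermFunction (fun y => σ y ⊓ τ y)
  | sup {σ τ : (S → M) → M} : IsTermFunction σ → IsTermFunction τ →
      IsTermFunction (fun y => σ y ⊔ τ y)
  | himp {σ τ : (S → M) → M} : IsTermFunction σ → IsTermFunction τ →
      IsTermFunction (fun y => σ y ⇨ τ y)

/-- `X ⊆ M^S` is term-closed: each point outside `X` is separated from `X` by a pair of `S`-ary
term functions which agree on `X`. -/
def IsTermClosed {M : Type u} [HeytingAlgebra M] {S : Type u} (X : Set (S → M)) : Prop :=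
  ∀ y, y ∉ X → ∃ σ τ : (S → M) → M,
    IsTermFunction σ ∧ IsTermFunction τ ∧ (∀ x ∈ X, σ x = τ x) ∧ σ y ≠ τ y

/-- `𝕄` yields a strong duality on `ISP(M)`: it yields a duality and every closed substructure of
a nonzero power of `𝕄` is term-closed. -/
def TotalAlterEgo.YieldsStrongDuality {M : Type u} [HeytingAlgebra M] [TopologicalSpace M]
    [DiscreteTopology M] (𝕄 : TotalAlterEgo M) : Prop :=
  𝕄.YieldsDuality ∧
    ∀ (S : Type u), Nonempty S → ∀ X : Set (S → M), 𝕄.IsClosedSubstructure S X → IsTermClosed X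

/-! ## Heyting homomorphisms and finite chains -/

/-! Either form of strong duality, for a total alter ego, makes `M` injective with respect to
embeddings `ι : A → B` of finite algebras in `ISP(M)` (`ExtendsFinite`). The homomorphisms `A → M`
that extend along `ι` form a substructure of `𝕄^A`, because a total operation applied to the
extensions extends the result. Strong duality then forces this substructure to be all of `Hom(A,
M)`.

Such injectivity fails for `n ≥ 4` (`not_extendsFinite`). Some `e : Cₙ → M` and `p : M → Cₙ` have a
composite that does not send the coatom to `⊤`, hence is the identity by rigidity of chains. Let
`ι₁, ι₂` embed `Cₙ₋₁` in `Cₙ`, omitting 1 and 2 respectively. Extending `e ∘ ι₂` along `ι₁` and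
composing with `p` gives an endomorphism `ψ` with `ψ ∘ ι₁ = ι₂`. It too is the identity by rigidity,
although `ι₁ ≠ ι₂`. -/

instance ULift.heytingAlgebra {α : Type v} [HeytingAlgebra α] : HeytingAlgebra (ULift.{u} α) :=
  letI : Top (ULift.{u} α) := ⟨⟨⊤⟩⟩
  letI : Bot (ULift.{u} α) := ⟨⟨⊥⟩⟩
  letI : HImp (ULift.{u} α) := ⟨fun a b => ⟨a.down ⇨ b.down⟩⟩
  ULift.down_injective.heytingAlgebra ULift.down Iff.rfl Iff.rfl (fun _ _ => rfl)
    (fun _ _ => rfl) rfl rfl (fun _ => rfl) (fun _ _ => rfl)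

namespace HeytingHom

/-- The projection `ULift α → α` as a Heyting homomorphism. -/
def down (α : Type v) [HeytingAlgebra α] : HeytingHom (ULift.{u} α) α where
  toFun := ULift.down
  map_sup' _ _ := rfl
  map_inf' _ _ := rfl
  map_bot' := rfl
  map_himp' _ _ := rfl

/-- The inclusion `α → ULift α` as a Heyting homomorphism. -/
def up (α : Type v) [HeytingAlgebra α] : HeytingHom α (ULift.{u} α) where
  toFun := ULift.up
  map_sup' _ _ := rfl
  map_inf' _ _ := rfl
  map_bot' := rfl
  map_himp' _ _ := rfl

/-- Evaluation at a coordinate of a power. -/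
def proj {S : Type u} (M : Type v) [HeytingAlgebra M] (s : S) : HeytingHom (S → M) M where
  toFun x := x s
  map_sup' _ _ := rfl
  map_inf' _ _ := rfl
  map_bot' := rfl
  map_himp' _ _ := rfl

/-- The inverse of a bijective Heyting homomorphism. -/
noncomputable def inverse {A : Type u} {B : Type v} [HeytingAlgebra A] [HeytingAlgebra B]
    (f : HeytingHom A B) (hf : Function.Bijective f) : HeytingHom B A where
  toFun := Function.surjInv hf.2
  map_sup' a b := hf.1 (by simp only [map_sup, Function.surjInv_eq])
  map_inf' a b := hf.1 (by simp only [map_inf, Function.surjInv_eq])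
  map_bot' := hf.1 (by simp only [map_bot, Function.surjInv_eq])
  map_himp' a b := hf.1 (by simp only [map_himp, Function.surjInv_eq])

theorem inverse_apply_apply {A : Type u} {B : Type v} [HeytingAlgebra A] [HeytingAlgebra B]
    (f : HeytingHom A B) (hf : Function.Bijective f) (a : A) : f.inverse hf (f a) = a :=
  hf.1 (Function.surjInv_eq hf.2 (f a))

end HeytingHom

/-! ### Rigidity of finite chains. -/

namespace GodelChain

/-- A strictly monotone map of chains preserving the bounds is a Heyting homomorphism. -/
def homOfStrictMono {m n : ℕ} [NeZero m] [NeZero n] (f : GodelChain m → GodelChain n)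
    (hf : StrictMono f) (hbot : f ⊥ = ⊥) (htop : f ⊤ = ⊤) :
    HeytingHom (GodelChain m) (GodelChain n) where
  toFun := f
  map_sup' a b := hf.monotone.map_max
  map_inf' a b := hf.monotone.map_min
  map_bot' := hbot
  map_himp' a b := by
    rw [himp_eq, himp_eq, apply_ite f, htop]
    simp only [hf.le_iff_le]

/-- The embedding of `Cₘ₊₂` into `Cₘ₊₃` whose range omits a prescribed element other than the
bounds. -/
def succAboveHom {m : ℕ} (i : Fin (m + 3)) (h0 : i ≠ 0) (h1 : i ≠ Fin.last (m + 2)) :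
    HeytingHom (GodelChain (m + 2)) (GodelChain (m + 3)) :=
  homOfStrictMono i.succAbove (Fin.strictMono_succAbove i)
    (Fin.succAbove_ne_zero_zero h0) (Fin.succAbove_ne_last_last h1)

theorem val_succAboveHom {m : ℕ} (i : Fin (m + 3)) (h0 : i ≠ 0) (h1 : i ≠ Fin.last (m + 2))
    (a : Fin (m + 2)) :
    (succAboveHom i h0 h1 a).val = if a.val < i.val then a.val else a.val + 1 := by
  change (i.succAbove a).val = _
  simp only [Fin.succAbove, Fin.lt_def, Fin.val_castSucc]
  split_ifs <;> simp

theorem succAboveHom_injective {m : ℕ} (i : Fin (m + 3)) (h0 : i ≠ 0)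
    (h1 : i ≠ Fin.last (m + 2)) : Function.Injective (succAboveHom i h0 h1) :=
  Fin.succAbove_right_injective

/-- A homomorphism on a chain is injective as soon as it does not send the coatom to `⊤`. -/
theorem injective_of_coatom {m : ℕ} {H : Type v} [HeytingAlgebra H]
    (f : HeytingHom (GodelChain (m + 2)) H) (hf : f (Fin.last m).castSucc ≠ ⊤) :
    Function.Injective f := by
  have key : ∀ a b : GodelChain (m + 2), a < b → f a ≠ f b := by
    intro a b hab h
    apply hf
    -- For `a < b` the implication `b ⇨ a` is `a`, so identifying `a` with `b` sends `a`, and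
    -- everything above it, to `⊤`.
    have h1 : f (b ⇨ a) = ⊤ := by rw [map_himp, h, himp_self]
    rw [himp_eq, if_neg hab.not_ge] at h1
    have hle : a ≤ (Fin.last m).castSucc := by
      rw [Fin.le_def]
      have := b.isLt
      have := Fin.lt_def.mp hab
      simp only [Fin.val_castSucc, Fin.val_last]
      omega
    exact top_le_iff.mp (h1 ▸ OrderHomClass.mono f hle)
  intro a b h
  rcases lt_trichotomy a b with hab | hab | hab
  · exact absurd h (key a b hab)
  · exact hab
  · exact absurd h.symm (key b a hab)

/-- The only endomorphism of a finite chain not sending the coatom to `⊤` is the identity. -/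
theorem eq_id_of_coatom {m : ℕ} (f : HeytingHom (GodelChain (m + 2)) (GodelChain (m + 2)))
    (hf : f (Fin.last m).castSucc ≠ ⊤) (a : GodelChain (m + 2)) : f a = a := by
  have hs : StrictMono f :=
    (OrderHomClass.mono f).strictMono_of_injective (injective_of_coatom f hf)
  exact le_antisymm hs.apply_le hs.le_apply

end GodelChain

/-! ## Extending homomorphisms along embeddings -/

theorem InISP.of_injective {A : Type u} [HeytingAlgebra A] {M : Type v} [HeytingAlgebra M]
    (f : HeytingHom A M) (hf : Function.Injective f) : InISP A M :=
  ⟨PUnit, { toFun := fun a _ => f a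
            map_sup' := fun a b => funext fun _ => map_sup f a b
            map_inf' := fun a b => funext fun _ => map_inf f a b
            map_bot' := funext fun _ => map_bot f
            map_himp' := fun a b => funext fun _ => map_himp f a b },
    fun _ _ h => hf (congrFun h PUnit.unit)⟩

theorem InISP.exists_hom_ne {A : Type u} [HeytingAlgebra A] {M : Type v} [HeytingAlgebra M]
    (h : InISP A M) {a b : A} (hab : a ≠ b) : ∃ f : HeytingHom A M, f a ≠ f b := by
  obtain ⟨S, f, hf⟩ := h
  obtain ⟨s, hs⟩ := Function.ne_iff.mp (hf.ne hab)
  exact ⟨(HeytingHom.proj M s).comp f, hs⟩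

/-- Every homomorphism into `M` from a finite algebra extends along embeddings into finite algebras
of `ISP(M)`. -/
def ExtendsFinite (M : Type u) [HeytingAlgebra M] : Prop :=
  ∀ (A B : Type u) [HeytingAlgebra A] [HeytingAlgebra B] [Finite A] [Finite B]
    (ι : HeytingHom A B), Function.Injective ι → InISP B M →
      ∀ h : HeytingHom A M, ∃ h' : HeytingHom B M, h'.comp ι = h

/-- For `n ≥ 4`, a generator of `𝒢ₙ` is not injective with respect to embeddings of finite
algebras. This reflects the failure of the amalgamation property. -/
theorem not_extendsFinite {m : ℕ} (M : Type u) [HeytingAlgebra M]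
    (hM : ∀ (A : Type u) [HeytingAlgebra A], InISP A M ↔ InGodelVariety (m + 4) A) :
    ¬ ExtendsFinite M := by
  intro hext
  let C := GodelChain (m + 4)
  let c : C := (Fin.last (m + 2)).castSucc
  have hc : c ≠ ⊤ := (Fin.castSucc_lt_last _).ne
  have hC : InISP (ULift.{u} C) M :=
    (hM _).mpr (InISP.of_injective (HeytingHom.down C) ULift.down_injective)
  obtain ⟨e, he⟩ := hC.exists_hom_ne (a := ⟨c⟩) (b := ⟨⊤⟩) (fun h => hc (congrArg ULift.down h))
  obtain ⟨p, hp⟩ := ((hM M).mp (InISP.of_injective (HeytingHom.id M)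
    Function.injective_id)).exists_hom_ne he
  -- Two distinct elements other than the bounds are needed; this is where `n ≥ 4` enters.
  have h10 : (⟨1, by omega⟩ : Fin (m + 4)) ≠ 0 := by simp
  have h1l : (⟨1, by omega⟩ : Fin (m + 4)) ≠ Fin.last (m + 3) := by simp [Fin.ext_iff]
  have h20 : (⟨2, by omega⟩ : Fin (m + 4)) ≠ 0 := by simp [Fin.ext_iff]
  have h2l : (⟨2, by omega⟩ : Fin (m + 4)) ≠ Fin.last (m + 3) := by simp [Fin.ext_iff]
  let ι₁ : HeytingHom (GodelChain (m + 3)) C := GodelChain.succAboveHom _ h10 h1l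
  let ι₂ : HeytingHom (GodelChain (m + 3)) C := GodelChain.succAboveHom _ h20 h2l
  let lift (ι : HeytingHom (GodelChain (m + 3)) C) :
      HeytingHom (ULift.{u} (GodelChain (m + 3))) (ULift.{u} C) :=
    ((HeytingHom.up C).comp ι).comp (HeytingHom.down _)
  have hι₁ : Function.Injective (lift ι₁) := fun a b h =>
    ULift.down_injective (GodelChain.succAboveHom_injective _ h10 h1l (congrArg ULift.down h))
  obtain ⟨h', hh'⟩ := hext _ _ (lift ι₁) hι₁ hC (e.comp (lift ι₂))
  let φ : HeytingHom C C := (p.comp e).comp (HeytingHom.up C)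
  let ψ : HeytingHom C C := (p.comp h').comp (HeytingHom.up C)
  have htop : p (e ⟨⊤⟩) = ⊤ := by
    have : (⟨⊤⟩ : ULift.{u} C) = ⊤ := rfl
    rw [this, map_top, map_top]
  have hφ : ∀ a, φ a = a := GodelChain.eq_id_of_coatom φ (by
    intro h
    exact hp (h.trans htop.symm))
  have hφψ : ∀ a, ψ (ι₁ a) = φ (ι₂ a) := fun a => congrArg p (DFunLike.congr_fun hh' ⟨a⟩)
  have hd : ι₁ (Fin.last (m + 1)).castSucc = c := by
    refine Fin.ext ((GodelChain.val_succAboveHom _ h10 h1l _).trans ?_)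
    simp [c]
  -- `ι₁` maps coatom to coatom, so `ψ c` is a value of `ι₂` at an element below `⊤`.
  have hψ : ∀ a, ψ a = a := GodelChain.eq_id_of_coatom ψ (by
    change ψ c ≠ ⊤
    rw [← hd, hφψ, hφ]
    intro h
    have hinj : Function.Injective ι₂ := GodelChain.succAboveHom_injective _ h20 h2l
    exact (Fin.castSucc_lt_last (Fin.last (m + 1))).ne (hinj (h.trans (map_top ι₂).symm)))
  -- Here `ι₁ 1 = 2`, as 1 is skipped, while `ι₂ 1 = 1`.
  have heq := hφψ (⟨1, by omega⟩ : Fin (m + 3))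
  rw [hψ, hφ] at heq
  have hval := (GodelChain.val_succAboveHom _ h10 h1l _).symm.trans
    ((congrArg Fin.val heq).trans (GodelChain.val_succAboveHom _ h20 h2l _))
  simp at hval

/-! ## Strong dualities force extension of homomorphisms -/

/-- A term function acts on homomorphisms as evaluation at an element of their domain. -/
theorem IsTermFunction.exists_eq_apply {M A : Type u} [HeytingAlgebra M] [HeytingAlgebra A]
    {σ : (A → M) → M} (hσ : IsTermFunction σ) : ∃ a : A, ∀ x : HeytingHom A M, σ x = x a := by
  induction hσ with
  | proj s => exact ⟨s, fun _ => rfl⟩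
  | bot => exact ⟨⊥, fun x => (map_bot x).symm⟩
  | top => exact ⟨⊤, fun x => (map_top x).symm⟩
  | inf _ _ h₁ h₂ =>
    obtain ⟨⟨a, ha⟩, b, hb⟩ := And.intro h₁ h₂
    exact ⟨a ⊓ b, fun x => by simp only [map_inf, ha, hb]⟩
  | sup _ _ h₁ h₂ =>
    obtain ⟨⟨a, ha⟩, b, hb⟩ := And.intro h₁ h₂
    exact ⟨a ⊔ b, fun x => by simp only [map_sup, ha, hb]⟩
  | himp _ _ h₁ h₂ =>
    obtain ⟨⟨a, ha⟩, b, hb⟩ := And.intro h₁ h₂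
    exact ⟨a ⇨ b, fun x => by simp only [map_himp, ha, hb]⟩

namespace TotalAlterEgo

variable {M : Type u} [HeytingAlgebra M] [TopologicalSpace M]
  {𝕄 : TotalAlterEgo M}

/-- On homomorphisms, term functions are evaluations at elements of `A`. Two of them agreeing on all
restrictions `x ∘ ι` come from the same element, since `ι` is injective and homomorphisms `B → M`
separate points. So no homomorphism `A → M` can be separated from the restrictions. -/
theorem YieldsStrongDuality.extendsFinite [Finite M] [DiscreteTopology M]
    (h𝕄 : 𝕄.YieldsStrongDuality) : ExtendsFinite M := by
  intro A B _ _ _ _ ι hι hB h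
  by_contra hcon
  let Z : Set (A → M) := Set.range fun x : HeytingHom B M => ⇑(x.comp ι)
  have hZ : 𝕄.IsClosedSubstructure A Z := by
    refine ⟨(Set.toFinite Z).isClosed, fun k g w hw => ?_⟩
    choose x hx using hw
    -- Totality is essential: a partial operation could be defined on the restrictions but not on
    -- their extensions to `B`.
    refine ⟨g.1.comp (HeytingHom.tuple x), ?_⟩
    funext a
    exact congrArg g.1 (funext fun i => congrFun (hx i) a)
  have hy : (h : A → M) ∉ Z := fun ⟨x, hx⟩ => hcon ⟨x, DFunLike.coe_injective hx⟩
  obtain ⟨σ, τ, hσ, hτ, heq, hne⟩ := h𝕄.2 A ⟨⊥⟩ Z hZ h hy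
  obtain ⟨a, ha⟩ := hσ.exists_eq_apply
  obtain ⟨b, hb⟩ := hτ.exists_eq_apply
  rw [ha, hb] at hne
  obtain ⟨x, hx⟩ := hB.exists_hom_ne (hι.ne fun hab : a = b => hne (hab ▸ rfl))
  have := heq _ ⟨x, rfl⟩
  rw [ha, hb] at this
  exact hx this

theorem inTopQuasivariety_power (S : Type u) [Nonempty S] : InTopQuasivariety (𝕄.power S) :=
  ⟨S, inferInstance, ⟨id, continuous_id, fun _ _ _ => rfl, fun _ _ _ h => h⟩,
    ⟨Topology.IsEmbedding.id, fun _ _ _ h => h⟩, by simp [Set.range_id]⟩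

/-! ### The image of the dual of an embedding, and its algebra of morphisms. -/

section ImageDual

variable {A B : Type u} [HeytingAlgebra A] [HeytingAlgebra B] (ι : HeytingHom A B)

variable (𝕄) in
/-- The substructure of `D(A)` formed by the homomorphisms that extend along `ι : A → B`; it is the
image of `D(ι) : D(B) → D(A)`. -/
def imageDual : 𝕄.Str where
  carrier := {h : HeytingHom A M // ∃ h' : HeytingHom B M, h'.comp ι = h}
  top := TopologicalSpace.induced (fun x => (x.1 : A → M)) inferInstance
  op _ g w := ⟨g.1.comp (HeytingHom.tuple fun i => (w i).1), by
    choose x hx using fun i => (w i).2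
    refine ⟨g.1.comp (HeytingHom.tuple x), HeytingHom.ext fun a => ?_⟩
    exact congrArg g.1 (funext fun i => DFunLike.congr_fun (hx i) a)⟩
  rel _ r := {w | ∀ a, (fun i => (w i).1 a) ∈ r.1}

/-- The inclusion of `imageDual` into the power `𝕄^A`. -/
def imageDualInclusion : Hom (𝕄.imageDual ι) (𝕄.power A) where
  toFun x := (x.1 : A → M)
  continuous_toFun := continuous_induced_dom
  map_op _ _ _ := rfl
  map_rel _ _ _ h := h

theorem imageDualInclusion_isEmbedding : (imageDualInclusion (𝕄 := 𝕄) ι).IsEmbedding where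
  isEmbedding_toFun := ⟨⟨rfl⟩, DFunLike.coe_injective.comp Subtype.val_injective⟩
  reflects_rel _ _ _ h := h

theorem inTopQuasivariety_imageDual [Finite M] [DiscreteTopology M] [Finite A] :
    InTopQuasivariety (𝕄.imageDual ι) :=
  ⟨A, ⟨⊥⟩, imageDualInclusion ι, imageDualInclusion_isEmbedding ι,
    Set.Finite.isClosed (X := A → M) (Set.toFinite _)⟩

/-- The inclusion of the dual `D(A)` into the power `𝕄^A`. -/
def dualInclusion (A : Type u) [HeytingAlgebra A] : Hom (𝕄.D A) (𝕄.power A) where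
  toFun := fun x : HeytingHom A M => (x : A → M)
  continuous_toFun := continuous_induced_dom
  map_op _ _ _ := rfl
  map_rel _ _ _ h := h

/-- Composition of morphisms. -/
def Hom.comp {X Y Z : 𝕄.Str} (ψ : Hom Y Z) (φ : Hom X Y) : Hom X Z where
  toFun := ψ.toFun ∘ φ.toFun
  continuous_toFun := ψ.continuous_toFun.comp φ.continuous_toFun
  map_op k g w := by
    simp only [Function.comp_apply, φ.map_op, ψ.map_op]
  map_rel k r w h := ψ.map_rel k r _ (φ.map_rel k r w h)

variable [DiscreteTopology M]

variable (𝕄) in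
/-- Evaluation as a homomorphism from `A` to the algebra `E` of `imageDual`. -/
def evalImageDual : HeytingHom A (E (𝕄.imageDual ι)) where
  toFun a :=
    { toFun := fun x => x.1 a
      continuous_toFun := (continuous_apply a).comp continuous_induced_dom
      map_op := fun _ _ _ => rfl
      map_rel := fun _ _ _ hw => hw a }
  map_sup' a b := E.toMap_injective (funext fun x => map_sup x.1 a b)
  map_inf' a b := E.toMap_injective (funext fun x => map_inf x.1 a b)
  map_bot' := E.toMap_injective (funext fun x => map_bot x.1)
  map_himp' a b := E.toMap_injective (funext fun x => map_himp x.1 a b)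

variable {ι}

theorem evalImageDual_injective (hι : Function.Injective ι) (hB : InISP B M) :
    Function.Injective (𝕄.evalImageDual ι) := by
  intro a b hab
  by_contra hne
  obtain ⟨x, hx⟩ := hB.exists_hom_ne (hι.ne hne)
  exact hx (congrFun (congrArg E.toMap hab) ⟨x.comp ι, x, rfl⟩)

/-- Injectivity extends a morphism to the whole power `𝕄^A`; its restriction to `D(A)` is an
evaluation, by duality. -/
theorem evalImageDual_surjective [Finite M] [Finite A] (hdual : 𝕄.YieldsDuality)
    (hinj : 𝕄.IsInjective) (hA : InISP A M) : Function.Surjective (𝕄.evalImageDual ι) := by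
  intro f
  have : Nonempty A := ⟨⊥⟩
  obtain ⟨β, hβ⟩ := hinj _ _ (inTopQuasivariety_imageDual ι) (inTopQuasivariety_power A)
    (imageDualInclusion ι) (imageDualInclusion_isEmbedding ι) f
  obtain ⟨a, ha⟩ := (hdual A hA).2 (β.comp (dualInclusion A))
  refine ⟨a, E.toMap_injective (funext fun x => ?_)⟩
  exact (congrFun (congrArg E.toMap ha) x.1).trans (hβ x)

end ImageDual

/-- Since `A` is isomorphic to `E` of the image dual, fullness puts `Hom(A, M)` in bijection with
its subset of extendable homomorphisms. As `Hom(A, M)` is finite, the subset is everything. -/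
theorem YieldsFullDuality.extendsFinite [Finite M] [DiscreteTopology M]
    (hfull : 𝕄.YieldsFullDuality) (hinj : 𝕄.IsInjective) :
    ExtendsFinite M := by
  intro A B _ _ _ _ ι hι hB h
  have hA : InISP A M := by
    obtain ⟨S, f, hf⟩ := hB
    exact ⟨S, f.comp ι, hf.comp hι⟩
  have hbij : Function.Bijective (𝕄.evalImageDual ι) :=
    ⟨evalImageDual_injective hι hB, evalImageDual_surjective hfull.1 hinj hA⟩
  obtain ⟨φ, ψ, hψφ, -⟩ := hfull.2 _ (inTopQuasivariety_imageDual (𝕄 := 𝕄) ι)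
  -- The isomorphism `φ` need not be compatible with evaluation, so `F` serves only for counting.
  let F : HeytingHom A M → HeytingHom A M := fun x =>
    (φ.toFun (x.comp ((𝕄.evalImageDual ι).inverse hbij))).1
  have hF : Function.Injective F := by
    intro x y hxy
    have h1 := (Function.LeftInverse.injective hψφ) (Subtype.val_injective hxy)
    refine HeytingHom.ext fun a => ?_
    have h2 := DFunLike.congr_fun (F := HeytingHom (E (𝕄.imageDual ι)) M) h1
      (𝕄.evalImageDual ι a)
    simpa only [HeytingHom.comp_apply, HeytingHom.inverse_apply_apply] using h2
  have : Finite (HeytingHom A M) := DFunLike.finite _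
  obtain ⟨x, rfl⟩ := (Finite.injective_iff_surjective.mp hF) h
  exact (φ.toFun (x.comp ((𝕄.evalImageDual ι).inverse hbij))).2

end TotalAlterEgo

/-- For `n ≥ 4` the variety `𝒢ₙ` admits no total single-sorted strong duality: whatever finite
algebra `M` with `ISP(M) = 𝒢ₙ` is chosen, no total alter ego of `M` yields a strong duality, neither
in the sense of term-closed closed substructures nor in the equivalent sense of a full duality with
an injective alter ego. -/
theorem corollary6p2 (n : ℕ) [NeZero n] (hn : 4 ≤ n)
    (M : Type u) [HeytingAlgebra M] [Finite M] [TopologicalSpace M] [DiscreteTopology M]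
    (hM : ∀ (A : Type u) [HeytingAlgebra A], InISP A M ↔ InGodelVariety n A) :
    (¬ ∃ 𝕄 : TotalAlterEgo M, 𝕄.YieldsStrongDuality) ∧
      ¬ ∃ 𝕄 : TotalAlterEgo M, 𝕄.YieldsFullDuality ∧ 𝕄.IsInjective := by
  obtain ⟨m, rfl⟩ := Nat.exists_eq_add_of_le' hn
  have hne := not_extendsFinite M hM
  exact ⟨fun ⟨_, h⟩ => hne h.extendsFinite, fun ⟨_, h, hinj⟩ => hne (h.extendsFinite hinj)⟩
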